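/- **Corollary 4.2 (CyS).** Let $0<r<\infty$, $m_2\in\mathbb N$, let $L_2^{m_2}(0,r)$ be the Hilbert space of square integrable $\mathbb C^{m_2}$-valued functions on $(0,r)$, and let $\mathcal A f=\mathrm i\int_0^x f(t)\,dt$ on this space. Let $S$ be a bounded operator on $L_2^{m_2}(0,r)$ such that $$\mathcal A S+S\mathcal A^*=Z,\qquad Z=\int_0^r\mathcal Z(x,t)\,\cdot\,dt ,$$ where $Z$ is a bounded integral operator with a measurable $m_2\times m_2$ matrix kernel $\mathcal Z$ on $(0,r)\times(0,r)$ (that is, for each $f\in L_2^{m_2}(0,r)$ the function $\mathcal Z(x,\cdot)f$ is integrable and $(Zf)(x)=\int_0^r\mathcal Z(x,t)f(t)\,dt$ for almost every $x$). Then there is an $m_2\times m_2$ matrix function $\upsilon$ with $$\upsilon(x)=0\quad(0\le x\le r),\qquad \upsilon\in L_2^{m_2\times m_2}(r,2r),$$ such that, for the matrix function $$\Upsilon(x,t)=\upsilon(x+t)-\frac{\mathrm i}{2}\int_{x-t}^{\min\{x+t,\,2r-x-t\}}\mathcal Z\Big(\frac{x+t+s}{2},\frac{x+t-s}{2}\Big)ds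 ,$$ the following holds. 1. For every $x\in[0,r]$ the integral defining $\Upsilon(x,t)$ converges for almost every $t\in(0,r)$; the function $\Upsilon(x,\cdot)$ coincides almost everywhere on $(0,r)$ with an absolutely continuous function, and its derivative satisfies $\frac{\partial}{\partial t}\Upsilon(x,\cdot)\in L_2^{m_2\times m_2}(0,r)$. 2. $S=\frac{d}{dx}\int_0^r\big(\frac{\partial}{\partial t}\Upsilon(x,t)\big)\,\cdot\,dt$; that is, for each $f\in L_2^{m_2}(0,r)$ the function $x\mapsto\int_0^r\frac{\partial\Upsilon}{\partial t}(x,t)f(t)\,dt$ is absolutely continuous on $[0,r]$ and its derivative equals $(Sf)(x)$ for almost every $x$. Moreover, $$\int_0^\xi\mathcal Z(\xi-t,t)\,dt=0$$ (the integral being convergent) for almost every $\xi\in[0,r]$. If $\mathcal Z$ is bounded on $[0,r]\times[0,r]$ and continuous there off the diagonal $x=t$, then the last equality holds for every $\xi\in[0,r]$, and, for the same $\upsilon$, $\Upsilon(x,\cdot)$ itself is absolutely continuous on $[0,r]$ for every $x\in[0,r]$. -/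

import Mathlib

open MeasureTheory Set
open scoped Matrix.Norms.L2Operator

noncomputable section

namespace StructuredOperator

/-- Lebesgue measure on the interval `(0, r)`. -/
abbrev intervalMeasure (r : ℝ) : Measure ℝ := volume.restrict (Ioo 0 r)

/-- The Hilbert space `L_2^m(0, r)` of square integrable functions on `(0, r)` with values in the
Hermitian space `ℂ^m`. -/
abbrev L2 (m : ℕ) (r : ℝ) : Type :=
  Lp (EuclideanSpace ℂ (Fin m)) 2 (intervalMeasure r)

/-- The product `M v` of an `m × m` matrix and a vector of `ℂ^m`. -/
abbrev act {m : ℕ} (M : Matrix (Fin m) (Fin m) ℂ) (v : EuclideanSpace ℂ (Fin m)) :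
    EuclideanSpace ℂ (Fin m) :=
  Matrix.toEuclideanCLM (n := Fin m) (𝕜 := ℂ) M v

variable {m : ℕ} {r : ℝ}

/-- The primitive `x ↦ i ∫_0^x f(t) dt` of `f ∈ L_2^m(0, r)`, extended to the whole axis by
extending `f` by zero outside of `(0, r)`. -/
def primitiveFun (f : L2 m r) (x : ℝ) : EuclideanSpace ℂ (Fin m) :=
  Complex.I • ∫ t in (0 : ℝ)..x, f t ∂(intervalMeasure r)

theorem integrable_L2 (f : L2 m r) : Integrable f (intervalMeasure r) :=
  (Lp.memLp f).integrable (by norm_num)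

theorem norm_primitiveFun_le (f : L2 m r) (x : ℝ) :
    ‖primitiveFun f x‖ ≤ (intervalMeasure r univ).toReal ^ (1 / 2 : ℝ) * ‖f‖ := by
  have h1 : ‖primitiveFun f x‖ ≤ ∫ t, ‖f t‖ ∂(intervalMeasure r) := by
    rw [primitiveFun, norm_smul, Complex.norm_I, one_mul]
    refine intervalIntegral.norm_integral_le_integral_norm_uIoc.trans ?_
    exact setIntegral_le_integral (integrable_L2 f).norm
      (Filter.Eventually.of_forall fun t => norm_nonneg _)
  have h2 : eLpNorm f 1 (intervalMeasure r) ≤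
      eLpNorm f 2 (intervalMeasure r) * (intervalMeasure r univ) ^ (1 / 2 : ℝ) := by
    have := eLpNorm_le_eLpNorm_mul_rpow_measure_univ (μ := intervalMeasure r) (p := 1) (q := 2)
      (by norm_num) (Lp.aestronglyMeasurable f)
    norm_num at this ⊢
    exact this
  refine h1.trans ?_
  have h3 : ∫ t, ‖f t‖ ∂(intervalMeasure r) = (eLpNorm f 1 (intervalMeasure r)).toReal := by
    rw [integral_norm_eq_lintegral_enorm (Lp.aestronglyMeasurable f), eLpNorm_one_eq_lintegral_enorm]
  rw [h3, Lp.norm_def, mul_comm, ENNReal.toReal_rpow, ← ENNReal.toReal_mul]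
  exact ENNReal.toReal_mono (ENNReal.mul_ne_top (Lp.eLpNorm_ne_top f)
    (ENNReal.rpow_ne_top_of_nonneg (by norm_num) (measure_ne_top _ _))) h2

theorem continuous_primitiveFun (f : L2 m r) : Continuous (primitiveFun f) := by
  have h := intervalIntegral.continuous_primitive (μ := intervalMeasure r)
    (fun _ _ => (integrable_L2 f).intervalIntegrable) 0
  exact Continuous.const_smul h Complex.I

theorem memLp_primitiveFun (f : L2 m r) : MemLp (primitiveFun f) 2 (intervalMeasure r) :=
  MemLp.of_bound (continuous_primitiveFun f).aestronglyMeasurable _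
    (Filter.Eventually.of_forall (norm_primitiveFun_le f))

/-- The integration operator `𝒜 f = i ∫_0^x f(t) dt` on `L_2^m(0, r)`. -/
def integrationOp (m : ℕ) (r : ℝ) : L2 m r →L[ℂ] L2 m r :=
  LinearMap.mkContinuousOfExistsBound
    { toFun := fun f => (memLp_primitiveFun f).toLp _
      map_add' := fun f g => by
        rw [← MemLp.toLp_add, MemLp.toLp_eq_toLp_iff]
        refine Filter.Eventually.of_forall fun x => ?_
        simp only [primitiveFun, Pi.add_apply]
        rw [← smul_add, ← intervalIntegral.integral_add
          (integrable_L2 f).intervalIntegrable (integrable_L2 g).intervalIntegrable]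
        congr 1
        refine intervalIntegral.integral_congr_ae ?_
        filter_upwards [Lp.coeFn_add f g] with t ht _ using ht
      map_smul' := fun c f => by
        rw [RingHom.id_apply, ← MemLp.toLp_const_smul, MemLp.toLp_eq_toLp_iff]
        refine Filter.Eventually.of_forall fun x => ?_
        simp only [primitiveFun, Pi.smul_apply]
        rw [smul_comm c Complex.I]
        congr 1
        refine Eq.trans ?_ (intervalIntegral.integral_smul c (fun t => f t))
        refine intervalIntegral.integral_congr_ae ?_
        filter_upwards [Lp.coeFn_smul c f] with t ht _ using ht }
    ⟨(intervalMeasure r univ).toReal ^ (2 : ENNReal).toReal⁻¹ *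
        (intervalMeasure r univ).toReal ^ (1 / 2 : ℝ), fun f => by
      have hm : (0 : ℝ) ≤ (intervalMeasure r univ).toReal ^ (1 / 2 : ℝ) := by positivity
      have h := Lp.norm_le_of_ae_bound (f := (memLp_primitiveFun f).toLp _) (μ := intervalMeasure r)
        (C := (intervalMeasure r univ).toReal ^ (1 / 2 : ℝ) * ‖f‖)
        (mul_nonneg hm (norm_nonneg _)) (by
          filter_upwards [(memLp_primitiveFun f).coeFn_toLp] with x hx
          rw [hx]
          exact norm_primitiveFun_le f x)
      rw [mul_assoc]
      exact h⟩

theorem integrationOp_apply (f : L2 m r) :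
    ∀ᵐ x ∂(intervalMeasure r), integrationOp m r f x = Complex.I • ∫ t in (0 : ℝ)..x, f t := by
  filter_upwards [(memLp_primitiveFun f).coeFn_toLp, ae_restrict_mem measurableSet_Ioo]
    with x hx hxr
  refine Eq.trans hx ?_
  rw [primitiveFun, intervalIntegral.integral_of_le hxr.1.le,
    intervalIntegral.integral_of_le hxr.1.le, Measure.restrict_restrict measurableSet_Ioc]
  have hI : Ioc 0 x ∩ Ioo 0 r = Ioc 0 x :=
    inter_eq_left.2 fun t ht => ⟨ht.1, ht.2.trans_lt hxr.2⟩
  rw [hI]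

/-- The bounded operator `Z` on `L_2^m(0, r)` is the integral operator `Z = ∫_0^r 𝒵(x, t) · dt`:
`𝒵` is a measurable kernel on the square and, for every `f`, the integral `∫_0^r 𝒵(x, t) f(t) dt`
converges and equals `(Z f)(x)` for almost every `x`. -/
def IsIntegralOp (Z : L2 m r →L[ℂ] L2 m r) (𝒵 : ℝ → ℝ → Matrix (Fin m) (Fin m) ℂ) : Prop :=
  AEStronglyMeasurable (fun p : ℝ × ℝ => 𝒵 p.1 p.2)
      ((intervalMeasure r).prod (intervalMeasure r)) ∧
    ∀ f : L2 m r, ∀ᵐ x ∂(intervalMeasure r),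
      Integrable (fun t => act (𝒵 x t) (f t)) (intervalMeasure r) ∧
        Z f x = ∫ t in (0 : ℝ)..r, act (𝒵 x t) (f t)

/-- `D` is the derivative on `(0, r)`, in the sense of absolutely continuous functions, of the
matrix function `g` (given up to its values on a null set), and `D` is square integrable. -/
def HasL2Deriv (r : ℝ) (g D : ℝ → Matrix (Fin m) (Fin m) ℂ) : Prop :=
  MemLp D 2 (intervalMeasure r) ∧
    ∃ C : Matrix (Fin m) (Fin m) ℂ,
      ∀ᵐ t ∂(intervalMeasure r), g t = C + ∫ τ in (0 : ℝ)..t, D τ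

/-- `S = d/dx ∫_0^r D(x, t) · dt`: for every `f ∈ L_2^m(0, r)` the function
`G(x) = ∫_0^r D(x, t) f(t) dt` is absolutely continuous on `[0, r]`, and `S f` is its derivative. -/
def IsDerivOfIntegralOp (S : L2 m r →L[ℂ] L2 m r) (D : ℝ → ℝ → Matrix (Fin m) (Fin m) ℂ) : Prop :=
  ∀ f : L2 m r,
    (∀ x ∈ Icc 0 r, (∫ t in (0 : ℝ)..r, act (D x t) (f t)) =
      (∫ t in (0 : ℝ)..r, act (D 0 t) (f t)) + ∫ y in (0 : ℝ)..x, S f y) ∧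
    ∀ᵐ x ∂(intervalMeasure r),
      HasDerivAt (fun y => ∫ t in (0 : ℝ)..r, act (D y t) (f t)) (S f x) x

/-- The integrand of `upsilon`: the kernel along the line `x + t = const`. -/
def lineKernel (𝒵 : ℝ → ℝ → Matrix (Fin m) (Fin m) ℂ) (x t s : ℝ) : Matrix (Fin m) (Fin m) ℂ :=
  𝒵 ((x + t + s) / 2) ((x + t - s) / 2)

/-- `Υ(x, t) = υ(x + t) - (i/2) ∫_{x - t}^{min{x + t, 2r - x - t}} 𝒵((x+t+s)/2, (x+t-s)/2) ds`. -/
def upsilon (r : ℝ) (𝒵 : ℝ → ℝ → Matrix (Fin m) (Fin m) ℂ) (υ : ℝ → Matrix (Fin m) (Fin m) ℂ)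
    (x t : ℝ) : Matrix (Fin m) (Fin m) ℂ :=
  υ (x + t) - (Complex.I / 2) •
    ∫ s in (x - t)..(min (x + t) (2 * r - x - t)), lineKernel 𝒵 x t s

/-- The kernel is bounded on `[0, r] × [0, r]` and continuous there off the diagonal. -/
def IsRegularKernel (r : ℝ) (𝒵 : ℝ → ℝ → Matrix (Fin m) (Fin m) ℂ) : Prop :=
  (∃ C : ℝ, ∀ x ∈ Icc 0 r, ∀ t ∈ Icc 0 r, ‖𝒵 x t‖ ≤ C) ∧
    ContinuousOn (fun p : ℝ × ℝ => 𝒵 p.1 p.2) {p | p.1 ∈ Icc 0 r ∧ p.2 ∈ Icc 0 r ∧ p.1 ≠ p.2}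

end StructuredOperator

end

open MeasureTheory Set
open scoped Matrix.Norms.L2Operator

noncomputable section

namespace StructuredOperator

/-! ### Primitives on `[0, r]`, and Fubini over a corner of the square. -/

section Primitives

variable {r : ℝ} {E : Type*} [NormedAddCommGroup E] [NormedSpace ℝ E]

/-! Test everything on the step vectors `1_{(0,t]} e_k`: let `U x t` be the matrix with entries
`⟨1_{(0,x]} e_j, S 1_{(0,t]} e_k⟩` (`potential`). It is jointly continuous and vanishes for `x = 0`
and for `t = 0`. Row `j` of its `t`-derivative is the conjugate of `S* 1_{(0,x]} e_j`, which
represents `f ↦ (∫_0^x S f)_j`. So `S = d/dx ∫ ∂_t U · dt` holds for every bounded `S`, with `∂_t U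
x` in `L_2` (`isDerivOfIntegralOp_primitiveKernel`).

The operator identity serves only to identify `U` with `Υ`. Paired with step vectors it says `i
∫_0^x U(y,t) dy - i ∫_0^t U(x,τ) dτ = ∫_0^x ∫_0^t 𝒵` (`potential_equation`), hence `𝒵 = i (∂_t U -
∂_x U)` almost everywhere (`kernel_ae_eq`): a transport equation with characteristics `x + t =
const`. As `𝒵` is known only up to null sets in the plane, the equation is first integrated over the
corner `y > x`, `y + τ < ξ`. The terms on the oblique side cancel, and differentiating in `ξ` gives
`U(x, η - x) = U(r, (η - r)⁺) - i ∫_x^{min(η,r)} 𝒵(y, η - y) dy` for almost every `η`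
(`characteristic_ae`).

Thus `υ η = U(r, (η - r)⁺)`. At `x = 0` both `U` and `υ` vanish on `[0, r]`, so the antidiagonal
integrals of `𝒵` vanish too. For a regular kernel both sides are continuous, and "almost every"
becomes "every". -/

theorem intervalIntegrable_of_mem_Icc {F : Type*} [NormedAddCommGroup F] {f : ℝ → F}
    (hf : Integrable f (intervalMeasure r)) {a b : ℝ} (ha : a ∈ Icc 0 r) (hb : b ∈ Icc 0 r) : IntervalIntegrable f volume a b := by
  rw [intervalIntegrable_iff]
  have h : IntegrableOn f (Icc 0 r) volume := (integrableOn_Icc_iff_integrableOn_Ioo (by finiteness) (by finiteness)).2 hf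
  exact h.mono_set (uIoc_subset_uIcc.trans (uIcc_subset_Icc ha hb))

theorem integral_indicator_Ioo (f : ℝ → E) {a b : ℝ} (ha : 0 ≤ a) (hab : a ≤ b) (hb : b ≤ r) :
    ∫ t, (Ioo a b).indicator f t ∂(intervalMeasure r) = ∫ t in a..b, f t := by
  rw [integral_indicator measurableSet_Ioo, Measure.restrict_restrict measurableSet_Ioo,
    inter_eq_left.2 (Ioo_subset_Ioo ha hb), intervalIntegral.integral_of_le hab,
    integral_Ioc_eq_integral_Ioo]

theorem ae_eq_of_intervalIntegral_eq [CompleteSpace E] {f g : ℝ → E} {a b : ℝ} (hab : a ≤ b)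
    (hf : IntervalIntegrable f volume a b) (hg : IntervalIntegrable g volume a b)
    (h : ∀ x ∈ Icc a b, ∫ t in a..x, f t = ∫ t in a..x, g t) :
    ∀ᵐ x ∂(volume.restrict (Ioo a b)), f x = g x := by
  rw [ae_restrict_iff' measurableSet_Ioo]
  filter_upwards [hf.ae_hasDerivAt_integral, hg.ae_hasDerivAt_integral] with x hfx hgx hx
  have hx' : x ∈ uIcc a b := by rw [uIcc_of_le hab]; exact Ioo_subset_Icc_self hx
  refine (hfx hx' a left_mem_uIcc).unique ((hgx hx' a left_mem_uIcc).congr_of_eventuallyEq ?_)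
  filter_upwards [Ioo_mem_nhds hx.1 hx.2] with y hy using h y (Ioo_subset_Icc_self hy)

/-- `U x` is, uniformly for `x ∈ [0, r]`, the primitive on `[0, r]` of the summable function
`D x`. -/
structure IsUniformPrimitive (r : ℝ) (U D : ℝ → ℝ → E) : Prop where
  integrable : ∀ x ∈ Icc 0 r, Integrable (D x) (intervalMeasure r)
  integral_eq : ∀ x ∈ Icc 0 r, ∀ t ∈ Icc 0 r, ∫ τ in (0 : ℝ)..t, D x τ = U x t
  bound : ∃ C : ℝ, ∀ x ∈ Icc 0 r, ∫ t, ‖D x t‖ ∂(intervalMeasure r) ≤ C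

theorem ae_hasDerivAt_of_integral_eq [CompleteSpace E] (hr : 0 ≤ r) {f F : ℝ → E}
    (hf : Integrable f (intervalMeasure r)) {c : E}
    (hF : ∀ x ∈ Icc 0 r, F x = c + ∫ t in (0 : ℝ)..x, f t) :
    ∀ᵐ x ∂(intervalMeasure r), HasDerivAt F (f x) x := by
  have h := (intervalIntegrable_of_mem_Icc hf (left_mem_Icc.2 hr)
    (right_mem_Icc.2 hr)).ae_hasDerivAt_integral
  rw [intervalMeasure, ae_restrict_iff' measurableSet_Ioo]
  filter_upwards [h] with x hx hxr
  have hx' : x ∈ uIcc 0 r := by rw [uIcc_of_le hr]; exact Ioo_subset_Icc_self hxr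
  refine ((hx hx' 0 left_mem_uIcc).const_add c).congr_of_eventuallyEq ?_
  filter_upwards [Ioo_mem_nhds hxr.1 hxr.2] with y hy using hF y (Ioo_subset_Icc_self hy)

/-- The slices `D x` may be unrelated choices of representatives, so `D` need not be jointly
measurable. Since `U` is jointly continuous, `deriv (U x) t` is a jointly measurable replacement,
and the uniform bound on the slices makes it integrable on the square. -/
theorem IsUniformPrimitive.exists_integrable_prod [CompleteSpace E] (hr : 0 ≤ r)
    {U D : ℝ → ℝ → E} (hU : Continuous (Function.uncurry U)) (h : IsUniformPrimitive r U D) :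
    ∃ d : ℝ → ℝ → E, IsUniformPrimitive r U d ∧
      Integrable (Function.uncurry d) ((intervalMeasure r).prod (intervalMeasure r)) := by
  have hae : ∀ x ∈ Icc 0 r, D x =ᵐ[intervalMeasure r] fun t => deriv (U x) t := by
    intro x hx
    filter_upwards [ae_hasDerivAt_of_integral_eq hr (F := U x) (c := 0) (h.integrable x hx)
      (fun t ht => by rw [zero_add, h.integral_eq x hx t ht])] with t ht using ht.deriv.symm
  have hd : IsUniformPrimitive r U fun x t => deriv (U x) t := by
    obtain ⟨C, hC⟩ := h.bound
    refine ⟨fun x hx => (h.integrable x hx).congr (hae x hx), fun x hx t ht => ?_, C,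
      fun x hx => ?_⟩
    · rw [← h.integral_eq x hx t ht, intervalIntegral.integral_of_le ht.1,
        intervalIntegral.integral_of_le ht.1, integral_Ioc_eq_integral_Ioo,
        integral_Ioc_eq_integral_Ioo]
      exact integral_congr_ae (ae_mono (Measure.restrict_mono (Ioo_subset_Ioo_right ht.2) le_rfl)
        (hae x hx).symm)
    · exact (integral_congr_ae ((hae x hx).fun_comp (‖·‖))).symm.trans_le (hC x hx)
  refine ⟨_, hd, ?_⟩
  obtain ⟨C, hC⟩ := hd.bound
  have hm := aestronglyMeasurable_deriv_with_param hU
    ((intervalMeasure r).prod (intervalMeasure r))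
  refine (integrable_prod_iff hm).2 ⟨?_, ?_⟩
  · filter_upwards [ae_restrict_mem measurableSet_Ioo] with x hx
    exact hd.integrable x (Ioo_subset_Icc_self hx)
  · refine Integrable.of_bound hm.norm.integral_prod_right' C ?_
    filter_upwards [ae_restrict_mem measurableSet_Ioo] with x hx
    rw [Real.norm_of_nonneg (integral_nonneg fun _ => norm_nonneg _)]
    exact hC x (Ioo_subset_Icc_self hx)

/-- The part of the plane between the lines `y = x` and `y + τ = ξ`. -/
def corner (x ξ : ℝ) : Set (ℝ × ℝ) := {p | x < p.1 ∧ p.1 + p.2 < ξ}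

theorem measurableSet_corner (x ξ : ℝ) : MeasurableSet (corner x ξ) :=
  ((isOpen_lt continuous_const continuous_fst).inter
    (isOpen_lt (continuous_fst.add continuous_snd) continuous_const)).measurableSet

/-- This order of integration suits a kernel that is a derivative in its second variable, the next
one a derivative in the first. The restriction `ξ ≤ x + r` keeps the corner below the side `τ = r`;
the `max` with `0` accounts for the empty slices `y ≥ ξ`. -/
theorem setIntegral_corner_fst {g : ℝ → ℝ → E}
    (hg : Integrable (Function.uncurry g) ((intervalMeasure r).prod (intervalMeasure r)))
    {x ξ : ℝ} (hx : x ∈ Icc 0 r) (hξ : ξ ∈ Icc x (x + r)) :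
    ∫ p in corner x ξ, Function.uncurry g p ∂((intervalMeasure r).prod (intervalMeasure r)) =
      ∫ y in x..r, ∫ τ in (0 : ℝ)..max (ξ - y) 0, g y τ := by
  rw [← integral_indicator (measurableSet_corner x ξ),
    integral_prod _ (hg.indicator (measurableSet_corner x ξ)),
    ← integral_indicator_Ioo _ hx.1 hx.2 le_rfl]
  refine setIntegral_congr_fun measurableSet_Ioo fun y hy => ?_
  by_cases hxy : x < y
  · rw [indicator_of_mem (show y ∈ Ioo x r from ⟨hxy, hy.2⟩)]
    have h1 : max (ξ - y) 0 ≤ r := max_le (by linarith [hξ.2]) (hx.1.trans hx.2)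
    rw [← integral_indicator_Ioo _ le_rfl (le_max_right _ _) h1]
    refine setIntegral_congr_fun measurableSet_Ioo fun τ hτ => ?_
    by_cases h : y + τ < ξ
    · rw [indicator_of_mem (show (y, τ) ∈ corner x ξ from ⟨hxy, h⟩), indicator_of_mem]
      · rfl
      · exact ⟨hτ.1, lt_max_of_lt_left (by linarith)⟩
    · rw [indicator_of_notMem (fun hc : (y, τ) ∈ corner x ξ => h hc.2), indicator_of_notMem]
      rintro ⟨_, hc⟩
      rcases lt_max_iff.1 hc with hc | hc
      · exact h (by linarith)
      · exact hc.not_gt hτ.1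
  · rw [indicator_of_notMem (fun hc : y ∈ Ioo x r => hxy hc.1)]
    refine (setIntegral_congr_fun measurableSet_Ioo fun τ hτ => ?_).trans (integral_zero' ℝ E)
    exact indicator_of_notMem (fun hc : (y, τ) ∈ corner x ξ => hxy hc.1) _

theorem setIntegral_corner_snd {g : ℝ → ℝ → E}
    (hg : Integrable (Function.uncurry g) ((intervalMeasure r).prod (intervalMeasure r)))
    {x ξ : ℝ} (hx : x ∈ Icc 0 r) (hξ : ξ ∈ Icc x (x + r)) :
    ∫ p in corner x ξ, Function.uncurry g p ∂((intervalMeasure r).prod (intervalMeasure r)) =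
      ∫ τ in (0 : ℝ)..ξ - x, ∫ y in x..min r (ξ - τ), g y τ := by
  rw [← integral_indicator (measurableSet_corner x ξ),
    integral_prod_symm _ (hg.indicator (measurableSet_corner x ξ)),
    ← integral_indicator_Ioo (r := r) _ le_rfl (by linarith [hξ.1]) (by linarith [hξ.2])]
  refine setIntegral_congr_fun measurableSet_Ioo fun τ hτ => ?_
  by_cases hτξ : τ < ξ - x
  · rw [indicator_of_mem (show τ ∈ Ioo 0 (ξ - x) from ⟨hτ.1, hτξ⟩)]
    rw [← integral_indicator_Ioo (r := r) _ hx.1 (le_min hx.2 (by linarith)) (min_le_left _ _)]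
    refine setIntegral_congr_fun measurableSet_Ioo fun y hy => ?_
    by_cases h : x < y ∧ y + τ < ξ
    · rw [indicator_of_mem (show (y, τ) ∈ corner x ξ from h), indicator_of_mem]
      · rfl
      · exact ⟨h.1, lt_min hy.2 (by linarith [h.2])⟩
    · rw [indicator_of_notMem (fun hc : (y, τ) ∈ corner x ξ => h hc), indicator_of_notMem]
      rintro ⟨h1, hc⟩
      exact h ⟨h1, by linarith [(lt_min_iff.1 hc).2]⟩
  · rw [indicator_of_notMem (fun hc : τ ∈ Ioo 0 (ξ - x) => hτξ hc.2)]
    refine (setIntegral_congr_fun measurableSet_Ioo fun y hy => ?_).trans (integral_zero' ℝ E)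
    exact indicator_of_notMem
      (fun hc : (y, τ) ∈ corner x ξ => hτξ (by linarith [show x < y from hc.1, show y + τ < ξ from hc.2])) _

/-- The measure-preserving shear `(y, τ) ↦ (y, y + τ)` turns antidiagonals into slices, and Fubini
then gives both the integrability on almost every antidiagonal and the iterated integral. -/
theorem setIntegral_corner_line {g : ℝ → ℝ → E}
    (hg : Integrable (Function.uncurry g) ((intervalMeasure r).prod (intervalMeasure r)))
    {x : ℝ} (hx : x ∈ Icc 0 r) :
    (∀ᵐ η ∂(volume.restrict (Ioo x (x + r))),
      IntervalIntegrable (fun y => g y (η - y)) volume x (min η r)) ∧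
    IntervalIntegrable (fun η => ∫ y in x..min η r, g y (η - y)) volume x (x + r) ∧
    ∀ ξ ∈ Icc x (x + r),
      ∫ p in corner x ξ, Function.uncurry g p ∂((intervalMeasure r).prod (intervalMeasure r)) =
        ∫ η in x..ξ, ∫ y in x..min η r, g y (η - y) := by
  have hsq : MeasurableSet (Ioo 0 r ×ˢ Ioo 0 r) := measurableSet_Ioo.prod measurableSet_Ioo
  set G : ℝ → ℝ × ℝ → E := fun ξ =>
    (corner x ξ).indicator ((Ioo 0 r ×ˢ Ioo 0 r).indicator (Function.uncurry g)) with hG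
  have hGi : ∀ ξ, Integrable (G ξ) (volume.prod volume) := by
    intro ξ
    rw [intervalMeasure, Measure.prod_restrict] at hg
    exact (IntegrableOn.integrable_indicator hg hsq).indicator (measurableSet_corner x ξ)
  have hmp := measurePreserving_prod_neg_add (volume : Measure ℝ) (volume : Measure ℝ)
  have hGs : ∀ ξ, Integrable (fun q : ℝ × ℝ => G ξ (q.1, -q.1 + q.2)) (volume.prod volume) :=
    fun ξ => hmp.integrable_comp_of_integrable (hGi ξ)
  have hval : ∀ ξ ∈ Icc x (x + r), ∀ y η, G ξ (y, -y + η) =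
      (Ioo x ξ).indicator (fun η => (Ioo x (min η r)).indicator (fun y => g y (η - y)) y) η := by
    intro ξ hξ y η
    by_cases h : η < ξ ∧ x < y ∧ y < η ∧ y < r
    · obtain ⟨h1, h2, h3, h4⟩ := h
      rw [hG, indicator_of_mem (show η ∈ Ioo x ξ from ⟨h2.trans h3, h1⟩),
        indicator_of_mem (show y ∈ Ioo x (min η r) from ⟨h2, lt_min h3 h4⟩)]
      dsimp only
      rw [indicator_of_mem (show (y, -y + η) ∈ corner x ξ from ⟨h2, by simpa using h1⟩),
        indicator_of_mem]
      · simp only [Function.uncurry, neg_add_eq_sub]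
      · exact ⟨⟨hx.1.trans_lt h2, h4⟩, by simpa using h3,
          show -y + η < r by linarith [hξ.2]⟩
    · have hl : G ξ (y, -y + η) = 0 := by
        rw [hG]
        dsimp only
        rw [indicator_apply_eq_zero]
        rintro ⟨h1, h2⟩
        refine indicator_of_notMem ?_ _
        rintro ⟨⟨h3, h4⟩, h5, h6⟩
        simp at h1 h2 h3 h4 h5 h6
        exact h ⟨h2, h1, by linarith, h4⟩
      rw [hl]
      symm
      rw [indicator_apply_eq_zero]
      rintro ⟨h1, h2⟩
      refine indicator_of_notMem ?_ _
      rintro ⟨h3, h4⟩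
      exact h ⟨h2, h3, (lt_min_iff.1 h4).1, (lt_min_iff.1 h4).2⟩
  have hinner : ∀ ξ ∈ Icc x (x + r), ∀ η, ∫ y, G ξ (y, -y + η) =
      (Ioo x ξ).indicator (fun η => ∫ y in x..min η r, g y (η - y)) η := by
    intro ξ hξ η
    simp_rw [hval ξ hξ]
    by_cases hη : η ∈ Ioo x ξ
    · simp_rw [indicator_of_mem hη]
      rw [integral_indicator measurableSet_Ioo, intervalIntegral.integral_of_le
        (le_min hη.1.le hx.2), integral_Ioc_eq_integral_Ioo]
    · simp_rw [indicator_of_notMem hη]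
      exact integral_zero _ _
  have hr : 0 ≤ r := hx.1.trans hx.2
  have hmax : x + r ∈ Icc x (x + r) := right_mem_Icc.2 (by linarith)
  refine ⟨?_, ?_, fun ξ hξ => ?_⟩
  · rw [ae_restrict_iff' measurableSet_Ioo]
    filter_upwards [(hGs (x + r)).prod_left_ae] with η hη hηx
    simp_rw [hval _ hmax, indicator_of_mem hηx] at hη
    rw [intervalIntegrable_iff_integrableOn_Ioo_of_le (le_min hηx.1.le hx.2)]
    exact (integrable_indicator_iff measurableSet_Ioo).1 hη
  · rw [intervalIntegrable_iff_integrableOn_Ioo_of_le (by linarith)]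
    refine (integrable_indicator_iff measurableSet_Ioo).1 ?_
    have := (hGs (x + r)).integral_prod_right
    simp_rw [hinner _ hmax] at this
    exact this
  · have h1 : ∫ p in corner x ξ, Function.uncurry g p ∂((intervalMeasure r).prod (intervalMeasure r)) =
        ∫ p, G ξ p ∂(volume.prod volume) := by
      rw [hG]
      dsimp only
      rw [integral_indicator (measurableSet_corner x ξ), ← integral_indicator
        (measurableSet_corner x ξ), ← integral_indicator (measurableSet_corner x ξ),
        indicator_indicator, inter_comm, ← indicator_indicator, integral_indicator hsq,
        intervalMeasure, Measure.prod_restrict]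
    have h2 : ∫ p, G ξ p ∂(volume.prod volume) =
        ∫ q : ℝ × ℝ, G ξ (q.1, -q.1 + q.2) ∂(volume.prod volume) :=
      (MeasurePreserving.integral_comp' (f := (MeasurableEquiv.shearAddRight ℝ).symm) hmp
        (G ξ)).symm
    rw [h1, h2, integral_prod_symm _ (hGs ξ)]
    simp_rw [hinner ξ hξ]
    rw [integral_indicator measurableSet_Ioo, intervalIntegral.integral_of_le hξ.1,
      integral_Ioc_eq_integral_Ioo]

end Primitives

/-! ### The transport equation for a scalar potential and its integration along characteristics. -/

section Characteristics

variable {r : ℝ} {U d v z : ℝ → ℝ → ℂ}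

theorem integrable_prod_Ioc {E : Type*} [NormedAddCommGroup E] {g : ℝ × ℝ → E}
    (hg : Integrable g ((intervalMeasure r).prod (intervalMeasure r))) {a b : ℝ} (ha : a ≤ r)
    (hb : b ≤ r) :
    Integrable g ((volume.restrict (Ioc 0 a)).prod (volume.restrict (Ioc 0 b))) := by
  rw [intervalMeasure, Measure.restrict_congr_set Ioo_ae_eq_Ioc, Measure.prod_restrict] at hg
  rw [Measure.prod_restrict]
  exact hg.mono_measure (Measure.restrict_mono
    (prod_mono (Ioc_subset_Ioc_right ha) (Ioc_subset_Ioc_right hb)) le_rfl)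

/-- Measurability of `f` and `g` is what allows passing from slices to the product: the double
integral of `‖f - g‖ₑ` vanishes. -/
theorem ae_prod_eq_of_ae_ae_eq {α β E : Type*} [MeasurableSpace α] [MeasurableSpace β]
    [NormedAddCommGroup E] {μ : Measure α} {ν : Measure β} [SFinite ν] {f g : α × β → E}
    (hf : AEStronglyMeasurable f (μ.prod ν)) (hg : AEStronglyMeasurable g (μ.prod ν))
    (h : ∀ᵐ x ∂μ, ∀ᵐ y ∂ν, f (x, y) = g (x, y)) : f =ᵐ[μ.prod ν] g := by
  have hm : AEMeasurable (fun p => ‖f p - g p‖ₑ) (μ.prod ν) := (hf.sub hg).enorm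
  have h0 : ∫⁻ p, ‖f p - g p‖ₑ ∂(μ.prod ν) = 0 := by
    rw [lintegral_prod _ hm]
    refine (lintegral_congr_ae ?_).trans lintegral_zero
    filter_upwards [h] with x hx
    refine (lintegral_congr_ae ?_).trans lintegral_zero
    filter_upwards [hx] with y hy
    simp [hy]
  filter_upwards [(lintegral_eq_zero_iff' hm).1 h0] with p hp
  simpa [sub_eq_zero] using hp

/-- The integrated identity is differentiated first in `x`, for fixed `t`, and then in `t`, for
almost every fixed `y`. -/
theorem kernel_ae_eq (hr : 0 < r) (hU : Continuous (Function.uncurry U))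
    (hd : IsUniformPrimitive r U d)
    (hdi : Integrable (Function.uncurry d) ((intervalMeasure r).prod (intervalMeasure r)))
    (hv : IsUniformPrimitive r (fun t x => U x t) (fun t x => v x t))
    (hvi : Integrable (Function.uncurry v) ((intervalMeasure r).prod (intervalMeasure r)))
    (hzm : AEStronglyMeasurable (Function.uncurry z)
      ((intervalMeasure r).prod (intervalMeasure r)))
    (hz : ∀ᵐ y ∂(intervalMeasure r), Integrable (z y) (intervalMeasure r))
    (hzp : ∀ t ∈ Icc 0 r, Integrable (fun y => ∫ τ in (0 : ℝ)..t, z y τ) (intervalMeasure r))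
    (h : ∀ x ∈ Icc 0 r, ∀ t ∈ Icc 0 r,
      Complex.I * (∫ y in (0 : ℝ)..x, U y t) - Complex.I * (∫ τ in (0 : ℝ)..t, U x τ) =
        ∫ y in (0 : ℝ)..x, ∫ τ in (0 : ℝ)..t, z y τ) :
    Function.uncurry z =ᵐ[(intervalMeasure r).prod (intervalMeasure r)]
      fun p => Complex.I * (d p.1 p.2 - v p.1 p.2) := by
  have h0 : (0 : ℝ) ∈ Icc 0 r := left_mem_Icc.2 hr.le
  have h1 : r ∈ Icc 0 r := right_mem_Icc.2 hr.le
  have hUy : ∀ t, Continuous fun y => U y t := fun t => hU.comp (by fun_prop : Continuous (·, t))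
  have hvt : ∀ t ∈ Icc 0 r, IntervalIntegrable (fun y => ∫ τ in (0 : ℝ)..t, v y τ) volume 0 r := by
    intro t ht
    rw [intervalIntegrable_iff_integrableOn_Ioc_of_le hr.le]
    have := (integrable_prod_Ioc hvi le_rfl ht.2).integral_prod_left
    simp_rw [intervalIntegral.integral_of_le ht.1]
    exact this
  have step : ∀ t ∈ Icc 0 r, ∀ᵐ y ∂(intervalMeasure r),
      Complex.I * (U y t - ∫ τ in (0 : ℝ)..t, v y τ) = ∫ τ in (0 : ℝ)..t, z y τ := by
    intro t ht
    refine ae_eq_of_intervalIntegral_eq hr.le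
      ((((hUy t).intervalIntegrable _ _).sub (hvt t ht)).const_mul _)
      (intervalIntegrable_of_mem_Icc (hzp t ht) h0 h1) fun x hx => ?_
    rw [← h x hx t ht, intervalIntegral.integral_const_mul, intervalIntegral.integral_sub
      ((hUy t).intervalIntegrable _ _) ((hvt t ht).mono_set (by
        rw [uIcc_of_le hx.1, uIcc_of_le hr.le]; exact Icc_subset_Icc_right hx.2)), mul_sub]
    congr 2
    have hsw : ∫ τ in (0 : ℝ)..t, U x τ = ∫ τ in (0 : ℝ)..t, ∫ y in (0 : ℝ)..x, v y τ := by
      refine intervalIntegral.integral_congr fun τ hτ => ?_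
      rw [uIcc_of_le ht.1] at hτ
      exact (hv.integral_eq τ ⟨hτ.1, hτ.2.trans ht.2⟩ x hx).symm
    rw [hsw]
    simp_rw [intervalIntegral.integral_of_le ht.1, intervalIntegral.integral_of_le hx.1]
    exact integral_integral_swap (integrable_prod_Ioc hvi hx.2 ht.2)
  -- The exceptional null set of `step` depends on `t`. Rational `t` share one null set, and
  -- continuity in `t` then recovers the whole interval.
  have hall : ∀ᵐ y ∂(intervalMeasure r), ∀ q : ℚ, (q : ℝ) ∈ Icc 0 r →
      Complex.I * (U y q - ∫ τ in (0 : ℝ)..q, v y τ) = ∫ τ in (0 : ℝ)..q, z y τ := by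
    rw [ae_all_iff]
    intro q
    by_cases hq : (q : ℝ) ∈ Icc 0 r
    · filter_upwards [step q hq] with y hy _ using hy
    · exact Filter.Eventually.of_forall fun y hc => absurd hc hq
  refine ae_prod_eq_of_ae_ae_eq hzm
    ((hdi.aestronglyMeasurable.sub hvi.aestronglyMeasurable).const_mul _) ?_
  filter_upwards [hall, hz, hvi.prod_right_ae, ae_restrict_mem measurableSet_Ioo]
    with y hy hzy hvy hyr
  have hy' : y ∈ Icc 0 r := Ioo_subset_Icc_self hyr
  have hdI := intervalIntegrable_of_mem_Icc (hd.integrable y hy') h0 h1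
  have hvI : IntervalIntegrable (v y) volume 0 r := intervalIntegrable_of_mem_Icc hvy h0 h1
  have hzI := intervalIntegrable_of_mem_Icc hzy h0 h1
  have hsub : ∀ t ∈ Icc 0 r, uIcc 0 t ⊆ uIcc 0 r := fun t ht => by
    rw [uIcc_of_le ht.1, uIcc_of_le hr.le]; exact Icc_subset_Icc_right ht.2
  have hEq : EqOn (fun t => Complex.I * (U y t - ∫ τ in (0 : ℝ)..t, v y τ))
      (fun t => ∫ τ in (0 : ℝ)..t, z y τ) (Icc 0 r) := by
    have hcont : ∀ {f : ℝ → ℂ}, IntervalIntegrable f volume 0 r →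
        ContinuousOn (fun t => ∫ τ in (0 : ℝ)..t, f τ) (Icc 0 r) := fun {f} hf => by
      rw [← uIcc_of_le hr.le]
      exact intervalIntegral.continuousOn_primitive_interval' hf left_mem_uIcc
    have hs : EqOn (fun t => Complex.I * (U y t - ∫ τ in (0 : ℝ)..t, v y τ))
        (fun t => ∫ τ in (0 : ℝ)..t, z y τ) (Ioo 0 r ∩ range ((↑) : ℚ → ℝ)) := by
      rintro _ ⟨ht, q, rfl⟩
      exact hy q (Ioo_subset_Icc_self ht)
    refine hs.of_subset_closure (continuousOn_const.mul
      (ContinuousOn.sub (hU.comp (by fun_prop : Continuous (y, ·))).continuousOn (hcont hvI)))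
      (hcont hzI) (inter_subset_left.trans Ioo_subset_Icc_self) ?_
    rw [← closure_Ioo hr.ne]
    exact closure_minimal (Rat.denseRange_cast.open_subset_closure_inter isOpen_Ioo)
      isClosed_closure
  refine ae_eq_of_intervalIntegral_eq hr.le hzI ((hdI.sub hvI).const_mul _) fun t ht => ?_
  rw [intervalIntegral.integral_const_mul, intervalIntegral.integral_sub
    (hdI.mono_set (hsub t ht)) (hvI.mono_set (hsub t ht)), hd.integral_eq y hy' t ht]
  exact (hEq ht).symm

/-- Both integrals on the left run along the boundary of the corner. They agree on its oblique side,
and the bottom contributes nothing because `U y 0 = 0`; what survives is the side `y = r`, present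
only when `ξ > r`. -/
theorem intervalIntegral_edge (hr : 0 ≤ r) (hU : Continuous (Function.uncurry U))
    (hU0 : ∀ y ∈ Icc 0 r, U y 0 = 0) {x ξ : ℝ} (hx : x ∈ Icc 0 r) (hξ : x ≤ ξ) :
    (∫ τ in (0 : ℝ)..ξ - x, U (min r (ξ - τ)) τ) - ∫ y in x..r, U y (max (ξ - y) 0) =
      ∫ η in x..ξ, U r (max (η - r) 0) := by
  have hc : ∀ {a b : ℝ → ℝ}, Continuous a → Continuous b → ∀ p q,
      IntervalIntegrable (fun s => U (a s) (b s)) volume p q := fun ha hb p q =>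
    (hU.comp (ha.prodMk hb)).intervalIntegrable p q
  have hsub : ∫ τ in (0 : ℝ)..ξ - x, U (min r (ξ - τ)) τ =
      ∫ η in x..ξ, U (min r η) (ξ - η) := by
    have := intervalIntegral.integral_comp_sub_left (a := 0) (b := ξ - x)
      (fun η => U (min r η) (ξ - η)) ξ
    simpa using this
  rw [hsub]
  have hr0 : U r 0 = 0 := hU0 r ⟨hr, le_rfl⟩
  rcases le_total ξ r with hξr | hrξ
  · have e1 : ∫ y in ξ..r, U y (max (ξ - y) 0) = 0 := by
      refine intervalIntegral.integral_zero_ae (Filter.Eventually.of_forall fun y hy => ?_)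
      rw [uIoc_of_le hξr] at hy
      rw [max_eq_right (by linarith [hy.1]), hU0 y ⟨by linarith [hx.1, hy.1], hy.2⟩]
    have e2 : ∫ η in x..ξ, U r (max (η - r) 0) = 0 := by
      refine intervalIntegral.integral_zero_ae (Filter.Eventually.of_forall fun y hy => ?_)
      rw [uIoc_of_le hξ] at hy
      rw [max_eq_right (by linarith [hy.2]), hr0]
    rw [e2, ← intervalIntegral.integral_add_adjacent_intervals (b := ξ)
      (f := fun y => U y (max (ξ - y) 0))
      (hc (by fun_prop) (by fun_prop) x ξ) (hc (by fun_prop) (by fun_prop) ξ r), e1, add_zero,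
      sub_eq_zero]
    refine intervalIntegral.integral_congr fun y hy => ?_
    rw [uIcc_of_le hξ] at hy
    rw [min_eq_right (by linarith [hy.2]), max_eq_left (by linarith [hy.2])]
  · have e1 : ∫ η in x..r, U r (max (η - r) 0) = 0 := by
      refine intervalIntegral.integral_zero_ae (Filter.Eventually.of_forall fun y hy => ?_)
      rw [uIoc_of_le hx.2] at hy
      rw [max_eq_right (by linarith [hy.2]), hr0]
    have e2 : ∫ η in r..ξ, U r (max (η - r) 0) = ∫ η in r..ξ, U (min r η) (ξ - η) := by
      have a1 : ∫ η in r..ξ, U r (max (η - r) 0) = ∫ s in (0 : ℝ)..ξ - r, U r s := by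
        have := intervalIntegral.integral_comp_sub_right (a := r) (b := ξ) (fun s => U r s) r
        rw [sub_self] at this
        rw [← this]
        refine intervalIntegral.integral_congr fun y hy => ?_
        rw [uIcc_of_le hrξ] at hy
        rw [max_eq_left (by linarith [hy.1])]
      have a2 : ∫ η in r..ξ, U (min r η) (ξ - η) = ∫ s in (0 : ℝ)..ξ - r, U r s := by
        have := intervalIntegral.integral_comp_sub_left (a := r) (b := ξ) (fun s => U r s) ξ
        rw [sub_self] at this
        rw [← this]
        refine intervalIntegral.integral_congr fun y hy => ?_
        rw [uIcc_of_le hrξ] at hy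
        rw [min_eq_left hy.1]
      rw [a1, a2]
    have e3 : ∫ y in x..r, U y (max (ξ - y) 0) = ∫ y in x..r, U (min r y) (ξ - y) := by
      refine intervalIntegral.integral_congr fun y hy => ?_
      rw [uIcc_of_le hx.2] at hy
      rw [min_eq_right hy.2, max_eq_left (by linarith [hy.2])]
    rw [← intervalIntegral.integral_add_adjacent_intervals (b := r)
        (hc (by fun_prop) (by fun_prop) x r) (hc (by fun_prop) (by fun_prop) r ξ), e3,
      ← intervalIntegral.integral_add_adjacent_intervals (a := x) (b := r) (c := ξ)
        (f := fun η => U r (max (η - r) 0))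
        (hc (by fun_prop) (by fun_prop) x r) (hc (by fun_prop) (by fun_prop) r ξ), e1, e2]
    ring

/-- Integrating `z` over the corner in three ways and differentiating in `ξ` yields the integrated
transport equation on almost every characteristic. -/
theorem characteristic_ae (hr : 0 < r) (hU : Continuous (Function.uncurry U))
    (hd : IsUniformPrimitive r U d)
    (hdi : Integrable (Function.uncurry d) ((intervalMeasure r).prod (intervalMeasure r)))
    (hv : IsUniformPrimitive r (fun t x => U x t) (fun t x => v x t))
    (hvi : Integrable (Function.uncurry v) ((intervalMeasure r).prod (intervalMeasure r)))
    (hz : Function.uncurry z =ᵐ[(intervalMeasure r).prod (intervalMeasure r)]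
      fun p => Complex.I * (d p.1 p.2 - v p.1 p.2)) {x : ℝ} (hx : x ∈ Icc 0 r) :
    ∀ᵐ η ∂(volume.restrict (Ioo x (x + r))),
      IntervalIntegrable (fun y => z y (η - y)) volume x (min η r) ∧
      U r (max (η - r) 0) - Complex.I * (∫ y in x..min η r, z y (η - y)) = U x (η - x) := by
  have hdv : Integrable (fun p : ℝ × ℝ => Complex.I * (d p.1 p.2 - v p.1 p.2))
      ((intervalMeasure r).prod (intervalMeasure r)) := (hdi.sub hvi).const_mul _
  have hzi : Integrable (Function.uncurry z)
      ((intervalMeasure r).prod (intervalMeasure r)) := hdv.congr hz.symm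
  obtain ⟨h1, h2, h3⟩ := setIntegral_corner_line hzi hx
  have hc : ∀ {a b : ℝ → ℝ}, Continuous a → Continuous b → ∀ p q,
      IntervalIntegrable (fun s => U (a s) (b s)) volume p q := fun ha hb p q =>
    (hU.comp (ha.prodMk hb)).intervalIntegrable p q
  have hx0 : (0 : ℝ) ≤ x := hx.1
  have hU0 : ∀ y ∈ Icc 0 r, U y 0 = 0 := fun y hy => by
    rw [← hd.integral_eq y hy 0 (left_mem_Icc.2 hr.le), intervalIntegral.integral_same]
  have key : ∀ ξ ∈ Icc x (x + r),
      ∫ η in x..ξ, (U r (max (η - r) 0) - U x (η - x)) =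
        ∫ η in x..ξ, Complex.I * ∫ y in x..min η r, z y (η - y) := by
    intro ξ hξ
    have e0 : ∫ p in corner x ξ, (d p.1 p.2 - v p.1 p.2)
        ∂((intervalMeasure r).prod (intervalMeasure r)) = _ :=
      integral_sub hdi.integrableOn hvi.integrableOn
    rw [intervalIntegral.integral_const_mul, ← h3 ξ hξ,
      integral_congr_ae (ae_restrict_of_ae hz), integral_const_mul, e0]
    have e1 := setIntegral_corner_fst hdi hx hξ
    have e2 := setIntegral_corner_snd hvi hx hξ
    simp only [Function.uncurry] at e1 e2
    have e1' : ∫ y in x..r, ∫ τ in (0 : ℝ)..max (ξ - y) 0, d y τ =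
        ∫ y in x..r, U y (max (ξ - y) 0) := by
      refine intervalIntegral.integral_congr fun y hy => ?_
      rw [uIcc_of_le hx.2] at hy
      exact hd.integral_eq y ⟨hx0.trans hy.1, hy.2⟩ _
        ⟨le_max_right _ _, max_le (by linarith [hy.1, hξ.2]) hr.le⟩
    have e2' : ∫ τ in (0 : ℝ)..ξ - x, ∫ y in x..min r (ξ - τ), v y τ =
        ∫ τ in (0 : ℝ)..ξ - x, (U (min r (ξ - τ)) τ - U x τ) := by
      refine intervalIntegral.integral_congr fun τ hτ => ?_
      rw [uIcc_of_le (by linarith [hξ.1])] at hτ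
      have hτr : τ ∈ Icc 0 r := ⟨hτ.1, by linarith [hτ.2, hξ.2]⟩
      have hm : min r (ξ - τ) ∈ Icc 0 r :=
        ⟨le_min hr.le (by linarith [hτ.2]), min_le_left _ _⟩
      rw [← hv.integral_eq τ hτr _ hm, ← hv.integral_eq τ hτr x hx,
        intervalIntegral.integral_interval_sub_left]
      · exact intervalIntegrable_of_mem_Icc (hv.integrable τ hτr) (left_mem_Icc.2 hr.le) hm
      · exact intervalIntegrable_of_mem_Icc (hv.integrable τ hτr) (left_mem_Icc.2 hr.le) hx
    have e3 : ∫ η in x..ξ, U x (η - x) = ∫ τ in (0 : ℝ)..ξ - x, U x τ := by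
      have := intervalIntegral.integral_comp_sub_right (a := x) (b := ξ) (fun s => U x s) x
      rwa [sub_self] at this
    rw [intervalIntegral.integral_sub (hc (by fun_prop) (by fun_prop) _ _)
      (hc (by fun_prop) (by fun_prop) _ _), e3, e1, e2, e1', e2',
      intervalIntegral.integral_sub (hc (by fun_prop) (by fun_prop) _ _)
      (hc (by fun_prop) (by fun_prop) _ _), ← intervalIntegral_edge hr.le hU hU0 hx hξ.1,
      ← mul_assoc, Complex.I_mul_I]
    ring
  filter_upwards [h1, ae_eq_of_intervalIntegral_eq (by linarith)
    (IntervalIntegrable.sub (hc (by fun_prop) (by fun_prop) _ _)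
      (hc (by fun_prop) (by fun_prop) _ _)) (h2.const_mul _) key] with η hη1 hη2
  refine ⟨hη1, ?_⟩
  rw [← hη2]
  ring

end Characteristics

/-! ### Kernels that are bounded, and continuous off the diagonal. -/

section RegularKernel

variable {r : ℝ} {E : Type*} [NormedAddCommGroup E]

theorem aestronglyMeasurable_of_continuousOn_diff_singleton {f : ℝ → E} {a b p : ℝ}
    (hf : ContinuousOn f (Icc a b \ {p})) :
    AEStronglyMeasurable f (volume.restrict (Ioc a b)) := by
  have h := (hf.mono (sdiff_subset_sdiff_left Ioc_subset_Icc_self)).aestronglyMeasurable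
    (μ := volume) (measurableSet_Ioc.diff (measurableSet_singleton p))
  rwa [Measure.restrict_congr_set (sdiff_null_ae_eq_self (measure_singleton p))] at h

theorem intervalIntegrable_of_continuousOn_diff_singleton {f : ℝ → E} {a b p C : ℝ} (hab : a ≤ b)
    (hf : ContinuousOn f (Icc a b \ {p})) (hC : ∀ y ∈ Icc a b, ‖f y‖ ≤ C) :
    IntervalIntegrable f volume a b := by
  rw [intervalIntegrable_iff_integrableOn_Ioc_of_le hab]
  refine Integrable.of_bound (aestronglyMeasurable_of_continuousOn_diff_singleton hf) C ?_
  filter_upwards [ae_restrict_mem measurableSet_Ioc] with y hy using hC y (Ioc_subset_Icc_self hy)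

theorem intervalIntegrable_antidiagonal {z : ℝ → ℝ → E} {C : ℝ}
    (hC : ∀ x ∈ Icc 0 r, ∀ t ∈ Icc 0 r, ‖z x t‖ ≤ C)
    (hz : ContinuousOn (fun p : ℝ × ℝ => z p.1 p.2)
      {p | p.1 ∈ Icc 0 r ∧ p.2 ∈ Icc 0 r ∧ p.1 ≠ p.2}) {ξ : ℝ} (hξ : ξ ∈ Icc 0 r) :
    IntervalIntegrable (fun t => z (ξ - t) t) volume 0 ξ := by
  refine intervalIntegrable_of_continuousOn_diff_singleton (p := ξ / 2) hξ.1 ?_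
    fun y hy => hC _ ⟨by linarith [hy.2], by linarith [hy.1, hξ.2]⟩ _ ⟨hy.1, hy.2.trans hξ.2⟩
  refine hz.comp (f := fun t : ℝ => (ξ - t, t)) (by fun_prop) fun y hy => ?_
  obtain ⟨hy, hne⟩ := hy
  refine ⟨⟨by linarith [hy.2], by linarith [hy.1, hξ.2]⟩, ⟨hy.1, hy.2.trans hξ.2⟩, fun h => hne ?_⟩
  simp only at h
  rw [mem_singleton_iff]
  linarith

/-- Rescaling to `[0, 1]` fixes the limits of integration. An antidiagonal crosses the diagonal at
most once, so dominated convergence applies where the length is positive; where it is zero,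
boundedness of the kernel suffices. -/
theorem continuousOn_integral_antidiagonal [NormedSpace ℝ E] {z : ℝ → ℝ → E} {C : ℝ}
    (hC : ∀ x ∈ Icc 0 r, ∀ t ∈ Icc 0 r, ‖z x t‖ ≤ C)
    (hz : ContinuousOn (fun p : ℝ × ℝ => z p.1 p.2)
      {p | p.1 ∈ Icc 0 r ∧ p.2 ∈ Icc 0 r ∧ p.1 ≠ p.2}) {x : ℝ} (hx : x ∈ Icc 0 r) :
    ContinuousOn (fun t => ∫ y in x..min (x + t) r, z y (x + t - y)) (Icc 0 r) := by
  -- The length of the interval of integration: `x + c t = min (x + t) r`.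
  set c : ℝ → ℝ := fun t => min t (r - x) with hc
  have hcc : Continuous c := by fun_prop
  have hc0 : ∀ t ∈ Icc 0 r, 0 ≤ c t := fun t ht => le_min ht.1 (by linarith [hx.2])
  have heq : ∀ t, ∫ y in x..min (x + t) r, z y (x + t - y) =
      c t • ∫ u in (0 : ℝ)..1, z (x + c t * u) (t - c t * u) := by
    intro t
    have h := intervalIntegral.smul_integral_comp_add_mul (a := 0) (b := 1)
      (fun y => z y (x + t - y)) (c t) x
    have e : x + c t = min (x + t) r := by
      rw [hc, ← min_add_add_left, add_sub_cancel]
    rw [mul_zero, mul_one, add_zero, e] at h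
    rw [← h]
    simp only [add_sub_add_left_eq_sub]
  simp_rw [heq]
  have hmem : ∀ t ∈ Icc 0 r, ∀ u ∈ Icc (0 : ℝ) 1,
      x + c t * u ∈ Icc 0 r ∧ t - c t * u ∈ Icc 0 r := by
    intro t ht u hu
    have h1 : 0 ≤ c t * u := mul_nonneg (hc0 t ht) hu.1
    have h2 : c t * u ≤ c t := mul_le_of_le_one_right (hc0 t ht) hu.2
    have h3 : c t ≤ t := min_le_left _ _
    have h4 : c t ≤ r - x := min_le_right _ _
    exact ⟨⟨by linarith [hx.1], by linarith⟩, by linarith, by linarith [ht.2]⟩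
  have hb : ∀ t ∈ Icc 0 r, ∀ u ∈ Icc (0 : ℝ) 1, ‖z (x + c t * u) (t - c t * u)‖ ≤ C :=
    fun t ht u hu => hC _ (hmem t ht u hu).1 _ (hmem t ht u hu).2
  intro t₀ ht₀
  rcases (hc0 t₀ ht₀).eq_or_lt with h0 | hpos
  · have hlim : Filter.Tendsto (fun t => |c t| * C) (nhdsWithin t₀ (Icc 0 r)) (nhds 0) := by
      have : Filter.Tendsto (fun t => |c t| * C) (nhds t₀) (nhds (|c t₀| * C)) :=
        (hcc.abs.mul continuous_const).tendsto t₀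
      rw [← h0, abs_zero, zero_mul] at this
      exact this.mono_left nhdsWithin_le_nhds
    rw [ContinuousWithinAt, ← h0, zero_smul]
    refine squeeze_zero_norm' ?_ hlim
    filter_upwards [self_mem_nhdsWithin] with t ht
    rw [norm_smul, Real.norm_eq_abs]
    refine mul_le_mul_of_nonneg_left ?_ (abs_nonneg _)
    have := intervalIntegral.norm_integral_le_of_norm_le_const (a := 0) (b := 1) (C := C)
      (f := fun u => z (x + c t * u) (t - c t * u)) (fun u hu => by
        rw [uIoc_of_le zero_le_one] at hu
        exact hb t ht u (Ioc_subset_Icc_self hu))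
    simpa using this
  · refine hcc.continuousWithinAt.smul ?_
    have hpos' : ∀ᶠ t in nhdsWithin t₀ (Icc 0 r), 0 < c t :=
      nhdsWithin_le_nhds (hcc.continuousAt.eventually (lt_mem_nhds hpos))
    refine intervalIntegral.continuousWithinAt_of_dominated_interval (bound := fun _ => C)
      ?_ ?_ intervalIntegrable_const ?_
    · filter_upwards [self_mem_nhdsWithin, hpos'] with t ht htp
      rw [uIoc_of_le zero_le_one]
      refine aestronglyMeasurable_of_continuousOn_diff_singleton (p := (t - x) / (2 * c t)) ?_
      refine hz.comp (f := fun u : ℝ => (x + c t * u, t - c t * u)) (by fun_prop) fun u hu => ?_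
      refine ⟨(hmem t ht u hu.1).1, (hmem t ht u hu.1).2, fun h => hu.2 ?_⟩
      simp only at h
      rw [mem_singleton_iff, eq_div_iff (by positivity)]
      linarith
    · filter_upwards [self_mem_nhdsWithin] with t ht
      refine Filter.Eventually.of_forall fun u hu => ?_
      rw [uIoc_of_le zero_le_one] at hu
      exact hb t ht u (Ioc_subset_Icc_self hu)
    · have hne : ∀ᵐ u : ℝ, u ≠ (t₀ - x) / (2 * c t₀) := by simp [ae_iff]
      filter_upwards [hne] with u hu hu1
      rw [uIoc_of_le zero_le_one] at hu1
      have hu1 := Ioc_subset_Icc_self hu1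
      have hcu : Continuous fun t => (x + c t * u, t - c t * u) := by fun_prop
      have hne₀ : x + c t₀ * u ≠ t₀ - c t₀ * u := fun h => hu (by
        rw [eq_div_iff (by positivity)]; linarith)
      refine Filter.Tendsto.comp (f := fun t => (x + c t * u, t - c t * u))
        (hz (x + c t₀ * u, t₀ - c t₀ * u)
          ⟨(hmem t₀ ht₀ u hu1).1, (hmem t₀ ht₀ u hu1).2, hne₀⟩).tendsto ?_
      refine tendsto_nhdsWithin_iff.2 ⟨hcu.continuousAt.tendsto.mono_left nhdsWithin_le_nhds, ?_⟩
      have hev : ∀ᶠ t in nhdsWithin t₀ (Icc 0 r), x + c t * u ≠ t - c t * u :=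
        nhdsWithin_le_nhds ((isOpen_ne_fun (by fun_prop) (by fun_prop)).mem_nhds hne₀)
      filter_upwards [self_mem_nhdsWithin, hev] with t ht htn
      exact ⟨(hmem t ht u hu1).1, (hmem t ht u hu1).2, htn⟩

end RegularKernel

/-! ### Step vectors, the potential of `S`, and the operator identity tested on them. -/

section SquareIntegrable

variable {m : ℕ} {r : ℝ}

/-- The element `1_{(0, t]} e_k` of `L_2^m(0, r)`. -/
def stepVec (r t : ℝ) (k : Fin m) : L2 m r :=
  indicatorConstLp 2 (measurableSet_Ioc : MeasurableSet (Ioc 0 t)) (measure_ne_top _ _)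
    (EuclideanSpace.single k 1)

/-- The intervals `(0, y]` and `(0, x]` differ by a set of measure at most `|y - x|`. This
continuity gives that of the potential and makes `∫ stepVec` a Bochner integral in `L_2`. -/
theorem continuous_stepVec (k : Fin m) : Continuous fun t => stepVec r t k := by
  refine continuous_indicatorConstLp_set (by norm_num) fun x => ?_
  have hb : ∀ y, intervalMeasure r (symmDiff (Ioc 0 y) (Ioc 0 x)) ≤ ENNReal.ofReal |y - x| := by
    intro y
    rw [← Real.volume_uIoc (a := x) (b := y)]
    refine (Measure.restrict_apply_le _ _).trans (measure_mono fun t ht => ?_)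
    rw [mem_symmDiff] at ht
    rw [mem_uIoc]
    rcases ht with ⟨⟨h1, h2⟩, h3⟩ | ⟨⟨h1, h2⟩, h3⟩
    · exact Or.inl ⟨not_le.1 fun h => h3 ⟨h1, h⟩, h2⟩
    · exact Or.inr ⟨not_le.1 fun h => h3 ⟨h1, h⟩, h2⟩
  refine tendsto_of_tendsto_of_tendsto_of_le_of_le tendsto_const_nhds ?_ (fun _ => zero_le) hb
  have : Continuous fun y : ℝ => ENNReal.ofReal |y - x| :=
    ENNReal.continuous_ofReal.comp (by fun_prop)
  simpa using this.tendsto x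

theorem stepVec_zero (k : Fin m) : stepVec r 0 k = 0 := by
  have h := Lp.norm_eq_zero_iff (f := stepVec r 0 k) (by norm_num : (0 : ENNReal) < 2)
  rw [← h, stepVec, norm_indicatorConstLp (by norm_num) (by norm_num)]
  simp

theorem setIntegral_Ioc_intervalMeasure {E : Type*} [NormedAddCommGroup E] [NormedSpace ℝ E]
    (f : ℝ → E) {t : ℝ} (ht : t ∈ Icc 0 r) :
    ∫ τ in Ioc 0 t, f τ ∂(intervalMeasure r) = ∫ τ in (0 : ℝ)..t, f τ := by
  rw [intervalIntegral.integral_of_le ht.1, intervalMeasure,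
    Measure.restrict_congr_set Ioo_ae_eq_Ioc, Measure.restrict_restrict measurableSet_Ioc,
    inter_eq_left.2 (Ioc_subset_Ioc_right ht.2)]

theorem inner_stepVec (f : L2 m r) (k : Fin m) {t : ℝ} (ht : t ∈ Icc 0 r) :
    inner ℂ (stepVec r t k) f = ∫ τ in (0 : ℝ)..t, f τ k := by
  rw [stepVec, L2.inner_indicatorConstLp_eq_setIntegral_inner,
    setIntegral_Ioc_intervalMeasure _ ht]
  simp [EuclideanSpace.inner_single_left]

theorem integrable_coord (f : L2 m r) (k : Fin m) :
    Integrable (fun t => f t k) (intervalMeasure r) :=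
  (integrable_L2 f).eval_piLp k

theorem integral_norm_le (f : L2 m r) : ∫ t, ‖f t‖ ∂(intervalMeasure r) ≤
    (intervalMeasure r univ).toReal ^ (1 / 2 : ℝ) * ‖f‖ := by
  have h2 : eLpNorm f 1 (intervalMeasure r) ≤
      eLpNorm f 2 (intervalMeasure r) * (intervalMeasure r univ) ^ (1 / 2 : ℝ) := by
    have := eLpNorm_le_eLpNorm_mul_rpow_measure_univ (μ := intervalMeasure r) (p := 1) (q := 2)
      (by norm_num) (Lp.aestronglyMeasurable f)
    norm_num at this ⊢
    exact this
  rw [integral_norm_eq_lintegral_enorm (Lp.aestronglyMeasurable f),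
    ← eLpNorm_one_eq_lintegral_enorm, Lp.norm_def, mul_comm, ENNReal.toReal_rpow,
    ← ENNReal.toReal_mul]
  exact ENNReal.toReal_mono (ENNReal.mul_ne_top (Lp.eLpNorm_ne_top f)
    (ENNReal.rpow_ne_top_of_nonneg (by norm_num) (measure_ne_top _ _))) h2

/-- Pairing with a step vector integrates a coordinate; the uniform `L_1` bound comes from
Cauchy–Schwarz and compactness of `[0, r]`. -/
theorem isUniformPrimitive_inner_stepVec {g : ℝ → L2 m r} (hg : Continuous g) (k : Fin m) :
    IsUniformPrimitive r (fun x t => inner ℂ (stepVec r t k) (g x)) (fun x t => g x t k) := by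
  obtain ⟨C, hC⟩ := isCompact_Icc.exists_bound_of_continuousOn (s := Icc 0 r) hg.continuousOn
  refine ⟨fun x _ => integrable_coord _ k, fun x _ t ht => (inner_stepVec _ k ht).symm,
    (intervalMeasure r univ).toReal ^ (1 / 2 : ℝ) * C, fun x hx => ?_⟩
  refine (integral_mono (integrable_coord _ k).norm (integrable_L2 _).norm
    fun t => PiLp.norm_apply_le _ _).trans ((integral_norm_le (g x)).trans ?_)
  exact mul_le_mul_of_nonneg_left (hC x hx) (by positivity)

theorem IsUniformPrimitive.conj {U D : ℝ → ℝ → ℂ} (h : IsUniformPrimitive r U D) :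
    IsUniformPrimitive r (fun x t => (starRingEnd ℂ) (U x t)) (fun x t => (starRingEnd ℂ) (D x t)) where
  integrable x hx := ((RCLike.conjCLE (K := ℂ)).toContinuousLinearMap).integrable_comp
    (h.integrable x hx)
  integral_eq x hx t ht := by
    rw [← h.integral_eq x hx t ht, intervalIntegral.integral_of_le ht.1,
      intervalIntegral.integral_of_le ht.1, integral_conj]
  bound := by simpa only [RCLike.norm_conj] using h.bound

theorem intervalIntegral_apply {f : ℝ → EuclideanSpace ℂ (Fin m)} {a b : ℝ}
    (hf : IntervalIntegrable f volume a b) (k : Fin m) :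
    (∫ t in a..b, f t) k = ∫ t in a..b, f t k :=
  ((EuclideanSpace.proj (𝕜 := ℂ) k).intervalIntegral_comp_comm hf).symm

theorem intervalIntegral_integrationOp (f : L2 m r) (k : Fin m) {t : ℝ} (ht : t ∈ Icc 0 r) :
    ∫ τ in (0 : ℝ)..t, integrationOp m r f τ k =
      Complex.I * ∫ τ in (0 : ℝ)..t, inner ℂ (stepVec r τ k) f := by
  rw [← intervalIntegral.integral_const_mul, ← setIntegral_Ioc_intervalMeasure _ ht,
    ← setIntegral_Ioc_intervalMeasure _ ht]
  refine integral_congr_ae (ae_restrict_of_ae ?_)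
  filter_upwards [integrationOp_apply f, ae_restrict_mem measurableSet_Ioo] with x hx hxr
  have hxr' : x ∈ Icc 0 r := Ioo_subset_Icc_self hxr
  rw [hx, inner_stepVec f k hxr', PiLp.smul_apply, smul_eq_mul, intervalIntegral_apply
    (intervalIntegrable_of_mem_Icc (integrable_L2 f) ⟨le_rfl, hxr'.1.trans hxr'.2⟩ hxr')]

/-- Writing the image as an average of step vectors lets `S` be taken under the integral in `S 𝒜*`,
so that only values of the potential appear. -/
theorem adjoint_integrationOp_stepVec (k : Fin m) {t : ℝ} (ht : t ∈ Icc 0 r) :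
    ContinuousLinearMap.adjoint (integrationOp m r) (stepVec r t k) =
      (-Complex.I) • ∫ τ in (0 : ℝ)..t, stepVec r τ k := by
  refine ext_inner_left ℂ fun f => ?_
  have hi : IntervalIntegrable (fun τ => stepVec r τ k) volume 0 t :=
    (continuous_stepVec k).intervalIntegrable _ _
  rw [ContinuousLinearMap.adjoint_inner_right, inner_smul_right, ← inner_conj_symm,
    inner_stepVec _ k ht, intervalIntegral_integrationOp f k ht, ← innerSL_apply_apply (𝕜 := ℂ),
    ← ContinuousLinearMap.intervalIntegral_comp_comm _ hi, map_mul, Complex.conj_I]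
  congr 1
  rw [intervalIntegral.integral_of_le ht.1, intervalIntegral.integral_of_le ht.1, ← integral_conj]
  simp only [innerSL_apply_apply, inner_conj_symm]

/-- The entry `(j, k)` of the matrix kernel whose derivatives represent the operator `S`. -/
def potential (S : L2 m r →L[ℂ] L2 m r) (j k : Fin m) (x t : ℝ) : ℂ :=
  inner ℂ (stepVec r x j) (S (stepVec r t k))

variable (S Z : L2 m r →L[ℂ] L2 m r)

theorem continuous_potential (j k : Fin m) :
    Continuous (Function.uncurry (potential S j k)) :=
  ((continuous_stepVec j).comp continuous_fst).inner
    (S.continuous.comp ((continuous_stepVec k).comp continuous_snd))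

theorem isUniformPrimitive_potential_left (j k : Fin m) :
    IsUniformPrimitive r (fun t x => potential S j k x t) (fun t x => S (stepVec r t k) x j) :=
  isUniformPrimitive_inner_stepVec (S.continuous.comp (continuous_stepVec k)) j

/-- Moving `S` to the other factor as its adjoint makes the potential a conjugated primitive in `t`.
-/
theorem isUniformPrimitive_potential_right (j k : Fin m) :
    IsUniformPrimitive r (potential S j k)
      (fun x t => (starRingEnd ℂ) (ContinuousLinearMap.adjoint S (stepVec r x j) t k)) := by
  have h := (isUniformPrimitive_inner_stepVec
    ((ContinuousLinearMap.adjoint S).continuous.comp (continuous_stepVec (r := r) j)) k).conj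
  simp only [Function.comp_apply, inner_conj_symm, ContinuousLinearMap.adjoint_inner_left] at h
  exact h

variable {S Z}

theorem potential_equation
    (hS : integrationOp m r ∘L S + S ∘L ContinuousLinearMap.adjoint (integrationOp m r) = Z)
    (j k : Fin m) {x t : ℝ} (hx : x ∈ Icc 0 r) (ht : t ∈ Icc 0 r) :
    Complex.I * (∫ y in (0 : ℝ)..x, potential S j k y t) -
        Complex.I * (∫ τ in (0 : ℝ)..t, potential S j k x τ) =
      ∫ y in (0 : ℝ)..x, Z (stepVec r t k) y j := by
  have hi : IntervalIntegrable (fun τ => stepVec r τ k) volume 0 t :=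
    (continuous_stepVec k).intervalIntegrable _ _
  rw [← inner_stepVec _ j hx, ← hS, add_apply, inner_add_right,
    ContinuousLinearMap.comp_apply, ContinuousLinearMap.comp_apply, inner_stepVec _ j hx,
    intervalIntegral_integrationOp _ j hx, adjoint_integrationOp_stepVec k ht, map_smul,
    inner_smul_right, neg_mul, ← sub_eq_add_neg, ← innerSL_apply_apply (𝕜 := ℂ),
    ← ContinuousLinearMap.comp_apply, ← ContinuousLinearMap.intervalIntegral_comp_comm _ hi]
  rfl

theorem act_single (M : Matrix (Fin m) (Fin m) ℂ) (j k : Fin m) (c : ℂ) :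
    act M (EuclideanSpace.single k c) j = M j k * c := by
  rw [act, Matrix.ofLp_toEuclideanCLM]
  simp

variable {𝒵 : ℝ → ℝ → Matrix (Fin m) (Fin m) ℂ}

theorem IsIntegralOp.ae_stepVec (hZ : IsIntegralOp Z 𝒵) (j k : Fin m) {t : ℝ}
    (ht : t ∈ Icc 0 r) :
    ∀ᵐ y ∂(intervalMeasure r), IntegrableOn (fun τ => 𝒵 y τ j k) (Ioc 0 t) (intervalMeasure r) ∧
      Z (stepVec r t k) y j = ∫ τ in (0 : ℝ)..t, 𝒵 y τ j k := by
  have hr : 0 ≤ r := ht.1.trans ht.2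
  filter_upwards [hZ.2 (stepVec r t k)] with y hy
  have hst : (fun τ => act (𝒵 y τ) (stepVec r t k τ) j) =ᵐ[intervalMeasure r]
      (Ioc 0 t).indicator fun τ => 𝒵 y τ j k := by
    filter_upwards [indicatorConstLp_coeFn (p := 2) (μ := intervalMeasure r)
      (hs := (measurableSet_Ioc : MeasurableSet (Ioc 0 t))) (hμs := measure_ne_top _ _)
      (c := EuclideanSpace.single k (1 : ℂ))] with τ hτ
    rw [stepVec, hτ]
    by_cases h : τ ∈ Ioc 0 t
    · rw [indicator_of_mem h, indicator_of_mem h, act_single, mul_one]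
    · rw [indicator_of_notMem h, indicator_of_notMem h, act, map_zero]
      rfl
  have hint := (hy.1.eval_piLp j).congr hst
  refine ⟨(integrable_indicator_iff measurableSet_Ioc).1 hint, ?_⟩
  have h0 : (0 : ℝ) ∈ Icc 0 r := ⟨le_rfl, hr⟩
  have h1 : r ∈ Icc 0 r := ⟨hr, le_rfl⟩
  rw [hy.2, intervalIntegral_apply (intervalIntegrable_of_mem_Icc hy.1 h0 h1),
    ← setIntegral_Ioc_intervalMeasure _ h1, ← setIntegral_Ioc_intervalMeasure _ ht,
    integral_congr_ae (ae_restrict_of_ae hst), setIntegral_indicator measurableSet_Ioc,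
    inter_eq_right.2 (Ioc_subset_Ioc_right ht.2)]

/-- Here the scalar theory is applied entrywise, after replacing both partial derivatives of the
potential by jointly integrable versions. -/
theorem potential_ae_eq (hr : 0 < r) (hZ : IsIntegralOp Z 𝒵)
    (hS : integrationOp m r ∘L S + S ∘L ContinuousLinearMap.adjoint (integrationOp m r) = Z)
    (j k : Fin m) {x : ℝ} (hx : x ∈ Icc 0 r) :
    ∀ᵐ η ∂(volume.restrict (Ioo x (x + r))),
      IntervalIntegrable (fun y => 𝒵 y (η - y) j k) volume x (min η r) ∧
      potential S j k r (max (η - r) 0) -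
        Complex.I * (∫ y in x..min η r, 𝒵 y (η - y) j k) = potential S j k x (η - x) := by
  have hU := continuous_potential S j k
  have hU' : Continuous (Function.uncurry fun t x => potential S j k x t) :=
    ((continuous_stepVec j).comp continuous_snd).inner
      (S.continuous.comp ((continuous_stepVec k).comp continuous_fst))
  obtain ⟨d, hd, hdi⟩ := (isUniformPrimitive_potential_right S j k).exists_integrable_prod hr.le hU
  obtain ⟨w, hw, hwi⟩ := (isUniformPrimitive_potential_left S j k).exists_integrable_prod hr.le hU'
  have hvi : Integrable (Function.uncurry fun x t => w t x)
      ((intervalMeasure r).prod (intervalMeasure r)) := Integrable.swap (f := Function.uncurry w) hwi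
  have hzm : AEStronglyMeasurable (Function.uncurry fun y τ => 𝒵 y τ j k)
      ((intervalMeasure r).prod (intervalMeasure r)) :=
    (continuous_id.matrix_elem j k).comp_aestronglyMeasurable hZ.1
  have hz : ∀ᵐ y ∂(intervalMeasure r), Integrable (fun τ => 𝒵 y τ j k) (intervalMeasure r) := by
    filter_upwards [hZ.ae_stepVec j k ⟨hr.le, le_rfl⟩] with y hy
    have h := hy.1
    rw [IntegrableOn, intervalMeasure, Measure.restrict_restrict measurableSet_Ioc,
      inter_eq_right.2 Ioo_subset_Ioc_self] at h
    exact h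
  have hzp : ∀ t ∈ Icc 0 r, (fun y => Z (stepVec r t k) y j) =ᵐ[intervalMeasure r]
      fun y => ∫ τ in (0 : ℝ)..t, 𝒵 y τ j k := fun t ht =>
    (hZ.ae_stepVec j k ht).mono fun y hy => hy.2
  refine characteristic_ae (z := fun y τ => 𝒵 y τ j k) hr hU hd hdi hw hvi
    (kernel_ae_eq hr hU hd hdi hw hvi hzm hz
      (fun t ht => (integrable_coord _ j).congr (hzp t ht)) fun x hx t ht => ?_) hx
  rw [potential_equation hS j k hx ht, ← setIntegral_Ioc_intervalMeasure _ hx,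
    ← setIntegral_Ioc_intervalMeasure _ hx]
  exact integral_congr_ae (ae_restrict_of_ae (hzp t ht))

end SquareIntegrable

/-! ### Passage from entries to matrices. -/

section MatrixValued

variable {m : ℕ} {r : ℝ} {α : Type*} [MeasurableSpace α] {μ : Measure α}
  {𝒵 : ℝ → ℝ → Matrix (Fin m) (Fin m) ℂ}

/-- Matrices as functions of two indices. -/
def entriesCLE (m : ℕ) : Matrix (Fin m) (Fin m) ℂ ≃L[ℂ] (Fin m → Fin m → ℂ) :=
  (Matrix.ofLinearEquiv ℂ).symm.toContinuousLinearEquiv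

theorem memLp_matrix_iff {f : α → Matrix (Fin m) (Fin m) ℂ} {p : ENNReal} :
    MemLp f p μ ↔ ∀ j k, MemLp (fun x => f x j k) p μ := by
  have h : MemLp f p μ ↔ MemLp (fun x => entriesCLE m (f x)) p μ := by
    refine ⟨fun hf => (entriesCLE m).toContinuousLinearMap.comp_memLp' hf, fun hf => ?_⟩
    have := (entriesCLE m).symm.toContinuousLinearMap.comp_memLp' hf
    simpa [Function.comp_def] using this
  rw [h, memLp_pi_iff]
  simp_rw [memLp_pi_iff]
  rfl

theorem integrable_matrix_iff {f : α → Matrix (Fin m) (Fin m) ℂ} :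
    Integrable f μ ↔ ∀ j k, Integrable (fun x => f x j k) μ := by
  simp_rw [← memLp_one_iff_integrable, memLp_matrix_iff]

theorem intervalIntegrable_matrix_iff {f : ℝ → Matrix (Fin m) (Fin m) ℂ} {a b : ℝ} :
    IntervalIntegrable f volume a b ↔
      ∀ j k, IntervalIntegrable (fun x => f x j k) volume a b := by
  simp_rw [intervalIntegrable_iff, IntegrableOn, integrable_matrix_iff]

theorem intervalIntegral_matrix_apply {f : ℝ → Matrix (Fin m) (Fin m) ℂ} {a b : ℝ}
    (hf : IntervalIntegrable f volume a b) (j k : Fin m) :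
    (∫ x in a..b, f x) j k = ∫ x in a..b, f x j k :=
  (((ContinuousLinearMap.proj k).comp ((ContinuousLinearMap.proj j).comp
    (entriesCLE m).toContinuousLinearMap)).intervalIntegral_comp_comm hf).symm

/-- Substitute `y = (x + t + s) / 2`; the Jacobian `2` absorbs the factor `1/2`. -/
theorem upsilon_eq (υ : ℝ → Matrix (Fin m) (Fin m) ℂ) (x t : ℝ) :
    upsilon r 𝒵 υ x t =
      υ (x + t) - Complex.I • ∫ y in x..min (x + t) r, 𝒵 y (x + t - y) := by
  have h := intervalIntegral.integral_comp_div_add (a := x - t) (b := min (x + t) (2 * r - x - t))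
    (fun y => 𝒵 y (x + t - y)) (two_ne_zero (α := ℝ)) ((x + t) / 2)
  have h1 : (x - t) / 2 + (x + t) / 2 = x := by ring
  have h2 : min (x + t) (2 * r - x - t) / 2 + (x + t) / 2 = min (x + t) r := by
    rw [← min_div_div_right (by norm_num), ← min_add_add_right]
    congr 1 <;> ring
  rw [h1, h2] at h
  have h3 : ∀ s, lineKernel 𝒵 x t s = 𝒵 (s / 2 + (x + t) / 2) (x + t - (s / 2 + (x + t) / 2)) :=
    fun s => by rw [lineKernel]; congr 1 <;> ring
  simp_rw [upsilon, h3]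
  rw [h, ← Complex.coe_smul, smul_smul]
  congr 2
  push_cast
  ring

theorem intervalIntegrable_lineKernel {x t : ℝ}
    (h : IntervalIntegrable (fun y => 𝒵 y (x + t - y)) volume x (min (x + t) r)) :
    IntervalIntegrable (lineKernel 𝒵 x t) volume (x - t) (min (x + t) (2 * r - x - t)) := by
  have h1 := (h.comp_add_right ((x + t) / 2)).comp_mul_left (c := 2⁻¹)
  have e1 : (x - (x + t) / 2) / 2⁻¹ = x - t := by ring
  have e2 : (min (x + t) r - (x + t) / 2) / 2⁻¹ = min (x + t) (2 * r - x - t) := by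
    rw [← min_sub_sub_right, ← min_div_div_right (by norm_num)]
    congr 1 <;> ring
  rw [e1, e2] at h1
  refine h1.congr fun s _ => ?_
  dsimp only [lineKernel]
  congr 1 <;> ring

theorem ae_comp_add_left {p : ℝ → Prop} {x : ℝ}
    (h : ∀ᵐ η ∂(volume.restrict (Ioo x (x + r))), p η) :
    ∀ᵐ t ∂(intervalMeasure r), p (x + t) := by
  rw [ae_restrict_iff' measurableSet_Ioo] at h ⊢
  filter_upwards [(measurePreserving_add_left volume x).quasiMeasurePreserving.ae h] with t ht htr
  exact ht ⟨by linarith [htr.1], by linarith [htr.2]⟩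

/-- The matrix kernel whose derivatives represent the operator `S`. -/
def potentialMatrix (S : L2 m r →L[ℂ] L2 m r) (x t : ℝ) : Matrix (Fin m) (Fin m) ℂ :=
  Matrix.of fun j k => potential S j k x t

/-- The kernel of the functional `f ↦ ∫_0^x (S f)(y) dy`. -/
def primitiveKernel (S : L2 m r →L[ℂ] L2 m r) (x t : ℝ) : Matrix (Fin m) (Fin m) ℂ :=
  Matrix.of fun j k => (starRingEnd ℂ) (ContinuousLinearMap.adjoint S (stepVec r x j) t k)

variable (S : L2 m r →L[ℂ] L2 m r)

theorem continuous_potentialMatrix {a b : ℝ → ℝ} (ha : Continuous a) (hb : Continuous b) :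
    Continuous fun s => potentialMatrix S (a s) (b s) :=
  continuous_matrix fun j k => by
    change Continuous fun s => Function.uncurry (potential S j k) (a s, b s)
    exact (continuous_potential S j k).comp (ha.prodMk hb)

theorem potentialMatrix_zero_left (t : ℝ) : potentialMatrix S 0 t = 0 := by
  ext j k
  simp [potentialMatrix, potential, stepVec_zero]

theorem potentialMatrix_zero_right (x : ℝ) : potentialMatrix S x 0 = 0 := by
  ext j k
  simp [potentialMatrix, potential, stepVec_zero]

theorem memLp_primitiveKernel (x : ℝ) : MemLp (primitiveKernel S x) 2 (intervalMeasure r) :=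
  memLp_matrix_iff.2 fun j k => (RCLike.conjCLE (K := ℂ)).toContinuousLinearMap.comp_memLp'
    ((Lp.memLp (ContinuousLinearMap.adjoint S (stepVec r x j))).eval_piLp k)

theorem integral_primitiveKernel (hr : 0 ≤ r) {x t : ℝ} (hx : x ∈ Icc 0 r) (ht : t ∈ Icc 0 r) :
    ∫ τ in (0 : ℝ)..t, primitiveKernel S x τ = potentialMatrix S x t := by
  ext j k
  rw [intervalIntegral_matrix_apply (intervalIntegrable_of_mem_Icc
    ((memLp_primitiveKernel S x).integrable (by norm_num)) ⟨le_rfl, hr⟩ ht)]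
  exact (isUniformPrimitive_potential_right S j k).integral_eq x hx t ht

/-- Coordinate `j` of the left side is `⟨S* 1_{(0,x]} e_j, f⟩ = ⟨1_{(0,x]} e_j, S f⟩`. The equation
for `S` plays no role. -/
theorem integral_act_primitiveKernel (hr : 0 ≤ r) (f : L2 m r) {x : ℝ} (hx : x ∈ Icc 0 r) :
    ∫ t in (0 : ℝ)..r, act (primitiveKernel S x t) (f t) = ∫ y in (0 : ℝ)..x, S f y := by
  have h0 : (0 : ℝ) ∈ Icc 0 r := ⟨le_rfl, hr⟩
  have h1 : r ∈ Icc 0 r := ⟨hr, le_rfl⟩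
  have hact : ∀ j t, act (primitiveKernel S x t) (f t) j =
      inner ℂ (ContinuousLinearMap.adjoint S (stepVec r x j) t) (f t) := by
    intro j t
    rw [act, Matrix.ofLp_toEuclideanCLM, PiLp.inner_apply]
    simp only [Matrix.mulVec, dotProduct, primitiveKernel, Matrix.of_apply, RCLike.inner_apply]
    exact Finset.sum_congr rfl fun _ _ => mul_comm _ _
  have hint : Integrable (fun t => act (primitiveKernel S x t) (f t)) (intervalMeasure r) := by
    refine Integrable.of_eval_piLp fun j => ?_
    simp_rw [hact]
    exact L2.integrable_inner _ _
  ext j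
  rw [intervalIntegral_apply (intervalIntegrable_of_mem_Icc hint h0 h1),
    intervalIntegral_apply (intervalIntegrable_of_mem_Icc (integrable_L2 _) h0 hx)]
  simp_rw [hact]
  rw [← inner_stepVec _ j hx, ← ContinuousLinearMap.adjoint_inner_left, L2.inner_def,
    intervalIntegral.integral_of_le hr, integral_Ioc_eq_integral_Ioo]

theorem isDerivOfIntegralOp_primitiveKernel (hr : 0 < r) :
    IsDerivOfIntegralOp S (primitiveKernel S) := by
  intro f
  have h0 : ∫ t in (0 : ℝ)..r, act (primitiveKernel S 0 t) (f t) = 0 := by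
    rw [integral_act_primitiveKernel S hr.le f ⟨le_rfl, hr.le⟩, intervalIntegral.integral_same]
  refine ⟨fun x hx => by rw [h0, zero_add, integral_act_primitiveKernel S hr.le f hx], ?_⟩
  exact ae_hasDerivAt_of_integral_eq hr.le (integrable_L2 _) (c := 0) fun x hx => by
    rw [zero_add, integral_act_primitiveKernel S hr.le f hx]

variable {S} {Z : L2 m r →L[ℂ] L2 m r}

theorem potentialMatrix_ae_eq (hr : 0 < r) (hZ : IsIntegralOp Z 𝒵)
    (hS : integrationOp m r ∘L S + S ∘L ContinuousLinearMap.adjoint (integrationOp m r) = Z)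
    {x : ℝ} (hx : x ∈ Icc 0 r) :
    ∀ᵐ t ∂(intervalMeasure r),
      IntervalIntegrable (fun y => 𝒵 y (x + t - y)) volume x (min (x + t) r) ∧
      potentialMatrix S r (max (x + t - r) 0) -
        Complex.I • (∫ y in x..min (x + t) r, 𝒵 y (x + t - y)) = potentialMatrix S x t := by
  have h : ∀ᵐ η ∂(volume.restrict (Ioo x (x + r))), ∀ j k,
      IntervalIntegrable (fun y => 𝒵 y (η - y) j k) volume x (min η r) ∧
      potential S j k r (max (η - r) 0) -
        Complex.I * (∫ y in x..min η r, 𝒵 y (η - y) j k) = potential S j k x (η - x) :=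
    ae_all_iff.2 fun j => ae_all_iff.2 fun k => potential_ae_eq hr hZ hS j k hx
  filter_upwards [ae_comp_add_left h] with t ht
  have hi := intervalIntegrable_matrix_iff.2 fun j k => (ht j k).1
  refine ⟨hi, ?_⟩
  ext j k
  have := (ht j k).2
  rw [add_sub_cancel_left] at this
  rw [Matrix.sub_apply, Matrix.smul_apply, intervalIntegral_matrix_apply hi]
  exact this

end MatrixValued

end StructuredOperator

end

open StructuredOperator in
theorem corollary4p2 {m : ℕ} {r : ℝ} (hr : 0 < r)
    (S Z : StructuredOperator.L2 m r →L[ℂ] StructuredOperator.L2 m r)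
    (𝒵 : ℝ → ℝ → Matrix (Fin m) (Fin m) ℂ)
    (hZ : StructuredOperator.IsIntegralOp Z 𝒵)
    (hS : StructuredOperator.integrationOp m r ∘L S +
      S ∘L ContinuousLinearMap.adjoint (StructuredOperator.integrationOp m r) = Z) :
    (∃ (υ : ℝ → Matrix (Fin m) (Fin m) ℂ) (D : ℝ → ℝ → Matrix (Fin m) (Fin m) ℂ),
      (∀ x ∈ Icc 0 r, υ x = 0) ∧
      MemLp υ 2 (volume.restrict (Ioo r (2 * r))) ∧
      (∀ x ∈ Icc 0 r, ∀ᵐ t ∂(volume.restrict (Ioo 0 r)),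
        IntervalIntegrable (StructuredOperator.lineKernel 𝒵 x t) volume
          (x - t) (min (x + t) (2 * r - x - t))) ∧
      (∀ x ∈ Icc 0 r,
        StructuredOperator.HasL2Deriv r (StructuredOperator.upsilon r 𝒵 υ x) (D x)) ∧
      StructuredOperator.IsDerivOfIntegralOp S D ∧
      (StructuredOperator.IsRegularKernel r 𝒵 → ∀ x ∈ Icc 0 r, ∀ t ∈ Icc 0 r,
        StructuredOperator.upsilon r 𝒵 υ x t =
          StructuredOperator.upsilon r 𝒵 υ x 0 + ∫ τ in (0 : ℝ)..t, D x τ)) ∧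
    (∀ᵐ ξ ∂(volume.restrict (Ioo 0 r)),
      IntervalIntegrable (fun t => 𝒵 (ξ - t) t) volume 0 ξ ∧
        ∫ t in (0 : ℝ)..ξ, 𝒵 (ξ - t) t = 0) ∧
    (StructuredOperator.IsRegularKernel r 𝒵 → ∀ ξ ∈ Icc 0 r,
      IntervalIntegrable (fun t => 𝒵 (ξ - t) t) volume 0 ξ ∧
        ∫ t in (0 : ℝ)..ξ, 𝒵 (ξ - t) t = 0) := by
  have h0 : (0 : ℝ) ∈ Icc 0 r := left_mem_Icc.2 hr.le
  have hr1 : r ∈ Icc 0 r := right_mem_Icc.2 hr.le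
  -- The boundary values of the potential on the side `x = r`; the `max` continues them continuously
  -- by `potentialMatrix S r 0 = 0` to `η ≤ r`.
  set υ : ℝ → Matrix (Fin m) (Fin m) ℂ := fun η => potentialMatrix S r (max (η - r) 0) with hυ
  have hυc : Continuous υ := continuous_potentialMatrix S continuous_const (by fun_prop)
  have hυ0 : ∀ x ≤ r, υ x = 0 := fun x hx => by
    rw [hυ]
    dsimp only
    rw [max_eq_right (by linarith), potentialMatrix_zero_right]
  have hΥ : ∀ x ∈ Icc 0 r, ∀ᵐ t ∂(intervalMeasure r),
      upsilon r 𝒵 υ x t = potentialMatrix S x t := fun x hx => by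
    filter_upwards [potentialMatrix_ae_eq hr hZ hS hx] with t ht
    rw [upsilon_eq]
    exact ht.2
  -- Two functions continuous on `[0, r]` that agree almost everywhere agree everywhere.
  have hΥreg : IsRegularKernel r 𝒵 → ∀ x ∈ Icc 0 r, ∀ t ∈ Icc 0 r,
      upsilon r 𝒵 υ x t = potentialMatrix S x t := by
    rintro ⟨⟨C, hC⟩, hcont⟩ x hx
    have hc : ContinuousOn (fun t => upsilon r 𝒵 υ x t) (Icc 0 r) := by
      simp_rw [upsilon_eq]
      exact (hυc.comp (by fun_prop : Continuous (x + ·))).continuousOn.sub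
        ((continuousOn_integral_antidiagonal hC hcont hx).const_smul Complex.I)
    refine Measure.eqOn_Icc_of_ae_eq volume hr.ne ?_ hc
      (continuous_potentialMatrix S continuous_const continuous_id).continuousOn
    rw [Measure.restrict_congr_set Ioo_ae_eq_Icc.symm]
    exact hΥ x hx
  -- At `x = 0` both the potential and `υ` drop out, leaving only the integral; the reflection `y =
  -- ξ - t` puts it in the required form.
  have hcv : ∀ ξ ∈ Icc 0 r, upsilon r 𝒵 υ 0 ξ = potentialMatrix S 0 ξ →
      ∫ t in (0 : ℝ)..ξ, 𝒵 (ξ - t) t = 0 := by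
    intro ξ hξ h
    rw [upsilon_eq, potentialMatrix_zero_left, zero_add, hυ0 ξ hξ.2, zero_sub, neg_eq_zero,
      smul_eq_zero_iff_right Complex.I_ne_zero, min_eq_left hξ.2] at h
    have := intervalIntegral.integral_comp_sub_left (a := 0) (b := ξ)
      (fun y => 𝒵 y (ξ - y)) ξ
    simp only [sub_sub_cancel, sub_self, sub_zero] at this
    rw [this, h]
  refine ⟨⟨υ, primitiveKernel S, fun x hx => hυ0 x hx.2, ?_, ?_, ?_,
    isDerivOfIntegralOp_primitiveKernel S hr, ?_⟩, ?_, ?_⟩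
  · obtain ⟨C, hC⟩ := isCompact_Icc.exists_bound_of_continuousOn (s := Icc r (2 * r))
      hυc.continuousOn
    refine MemLp.of_bound hυc.aestronglyMeasurable C ?_
    filter_upwards [ae_restrict_mem measurableSet_Ioo] with x hx using hC x (Ioo_subset_Icc_self hx)
  · intro x hx
    filter_upwards [potentialMatrix_ae_eq hr hZ hS hx] with t ht
    exact intervalIntegrable_lineKernel ht.1
  · intro x hx
    refine ⟨memLp_primitiveKernel S x, 0, ?_⟩
    filter_upwards [hΥ x hx, ae_restrict_mem measurableSet_Ioo] with t ht htr
    rw [ht, zero_add, integral_primitiveKernel S hr.le hx (Ioo_subset_Icc_self htr)]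
  · intro hreg x hx t ht
    rw [hΥreg hreg x hx t ht, hΥreg hreg x hx 0 h0, potentialMatrix_zero_right, zero_add,
      integral_primitiveKernel S hr.le hx ht]
  · filter_upwards [hΥ 0 h0, potentialMatrix_ae_eq hr hZ hS h0,
      ae_restrict_mem measurableSet_Ioo] with ξ hξ hξi hξr
    refine ⟨?_, hcv ξ (Ioo_subset_Icc_self hξr) hξ⟩
    have h := hξi.1.comp_sub_left ξ
    rw [zero_add, min_eq_left hξr.2.le] at h
    simpa using h.symm
  · intro hreg ξ hξ
    obtain ⟨⟨C, hC⟩, hcont⟩ := id hreg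
    exact ⟨intervalIntegrable_antidiagonal hC hcont hξ, hcv ξ hξ (hΥreg hreg 0 h0 ξ hξ)⟩
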